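/- Let $[n]=\{1,\dots,n\}$ and let $\log$ denote the base-2 logarithm. Sets $S_1,\dots,S_k\subseteq[n]$ form a *$k$-moonflower* if there is a set $I\subseteq[n]$ such that $S_1\setminus I,\dots,S_k\setminus I$ are all nonempty and pairwise disjoint; a family $\mathcal F\subseteq 2^{[n]}$ is *$k$-moonflower-free* if no $k$ members of it form a $k$-moonflower. A probability distribution $D$ on $2^{[n]}$ supported on $\mathcal F$ is *$p$-smooth* if $\Pr_{S\sim D}[i\in S]\le p$ for every $i\in[n]$. Write $\phi(p)=p\log(1/p)$, and let $H(D)=\sum_S D(S)\log(1/D(S))$ be the Shannon entropy (in bits, with $0\log(1/0)=0$). There is an absolute constant $B\ge 1$ such that the following holds. Let $\mathcal F\subseteq 2^{[n]}$ be $k$-moonflower-free, let $0<p\le 1/2$, and let $D$ be a $p$-smooth distribution supported on $\mathcal F$. If $n\ge 2k$, then $$H(D)\le B\cdot k\log(n/k)\cdot\phi(p).$$ More generally, if $n\ge k$, then $$H(D)\le B\cdot k\log(en/k)\cdot\phi(p).$$ -/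

import Mathlib

/-- The sets `S 0, …, S (k-1)` form a `k`-moonflower: for some set `I`, the sets `S i \ I` are
nonempty and pairwise disjoint. -/
def IsMoonflower {n k : ℕ} (S : Fin k → Finset (Fin n)) : Prop :=
  ∃ I : Finset (Fin n), (∀ i, (S i \ I).Nonempty) ∧
    ∀ i j, i ≠ j → Disjoint (S i \ I) (S j \ I)

/-- The family `F` contains no `k`-moonflower. -/
def MoonflowerFree {n : ℕ} (k : ℕ) (F : Finset (Finset (Fin n))) : Prop :=
  ¬ ∃ S : Fin k → Finset (Fin n), (∀ i, S i ∈ F) ∧ IsMoonflower S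

/-- The distribution `D` on subsets of `[n]` gives probability one to `F`. -/
def SupportedOn {n : ℕ} (D : PMF (Finset (Fin n))) (F : Finset (Finset (Fin n))) : Prop :=
  ∀ S, D S ≠ 0 → S ∈ F

/-- `Pr_{S ∼ D}[i ∈ S] ≤ p` for every coordinate `i`. -/
def IsSmooth {n : ℕ} (p : ℝ) (D : PMF (Finset (Fin n))) : Prop :=
  ∀ i : Fin n, ∑ S with i ∈ S, (D S).toReal ≤ p

/-- Shannon entropy in bits, `∑ D(S) log₂ (1 / D(S))`; terms with `D(S) = 0` vanish. -/
noncomputable def shannonEntropy {n : ℕ} (D : PMF (Finset (Fin n))) : ℝ :=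
  ∑ S, (D S).toReal * Real.logb 2 (1 / (D S).toReal)

/-- `φ(p) = p log₂ (1/p)`. -/
noncomputable def phi (p : ℝ) : ℝ := p * Real.logb 2 (1 / p)

/-! Take `m` independent copies of `S ∼ D`, with `m` about `1 / (4p)`, and bound the entropy of
their union `U` from both sides. Above: if the `m`-fold unions of members of `F` shattered a
`k`-set, singleton traces would give `k` members of `F` with private points, hence a moonflower. So
the VC dimension is below `k`, and Sauer–Shelah gives `H(U) ≤ k log(en/k)`
(`log_card_unionFamily_le`). Below: reveal the coordinates one at a time. Given the earlier
coordinates of every copy, the current bits are independent, and the bit of `U` is their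
disjunction. Smoothness makes the expected number of ones among the other copies at most `1/4`, so
the disjunction keeps the sum of the bit entropies up to a factor of order `1 + log m`
(`sum_one_sub_mul_binEntropy_le`, `mul_sum_splitEntropy_le`). The chain rule then gives `m H(D) ≤ 16
(1 + log m) H(U)` (`mul_varEntropy_le_varEntropy_biUnion`). Since `m ≥ 1 / (4p)` and `log m ≤
log(1/p)`, dividing by `m` produces `φ(p)`. -/

/-! ### Binary entropy of a disjunction, for fixed probabilities. -/

open Finset in
theorem one_sub_sum_le_prod_one_sub {ι : Type*} (s : Finset ι) (q : ι → ℝ)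
    (h0 : ∀ i ∈ s, 0 ≤ q i) (h1 : ∀ i ∈ s, q i ≤ 1) :
    1 - ∑ i ∈ s, q i ≤ ∏ i ∈ s, (1 - q i) := by
  classical
  induction s using Finset.induction_on with
  | empty => simp
  | insert a s ha ih =>
    rw [sum_insert ha, prod_insert ha]
    have ih' := ih (fun i hi => h0 i (mem_insert_of_mem hi)) fun i hi => h1 i (mem_insert_of_mem hi)
    have hs : 0 ≤ ∑ i ∈ s, q i := sum_nonneg fun i hi => h0 i (mem_insert_of_mem hi)
    have ha0 := h0 a (mem_insert_self a s)
    have ha1 := h1 a (mem_insert_self a s)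
    nlinarith [mul_le_mul_of_nonneg_left ih' (sub_nonneg.2 ha1)]

/-- The tangent line of `negMulLog` at `t` lies above its graph. -/
theorem Real.negMulLog_le_tangent {x t : ℝ} (hx : 0 ≤ x) (ht : 0 < t) :
    Real.negMulLog x ≤ x * -Real.log t + (t - x) := by
  rcases hx.eq_or_lt with rfl | hx
  · simpa using ht.le
  · have h := Real.log_le_sub_one_of_pos (div_pos ht hx)
    rw [Real.log_div ht.ne' hx.ne'] at h
    have h2 := mul_le_mul_of_nonneg_left h hx.le
    have h3 : x * (t / x - 1) = t - x := by field_simp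
    rw [h3] at h2
    rw [Real.negMulLog]
    linarith

/-- Upper bound for a sum of `negMulLog` in terms of the total and the number of terms. -/
theorem sum_negMulLog_le {ι : Type*} (s : Finset ι) (x : ι → ℝ) (hx : ∀ i ∈ s, 0 ≤ x i) :
    ∑ i ∈ s, Real.negMulLog (x i) ≤
      (∑ i ∈ s, x i) * Real.log s.card + Real.negMulLog (∑ i ∈ s, x i) := by
  rcases (Finset.sum_nonneg hx).eq_or_lt with h | h
  · rw [← h]
    have := (Finset.sum_eq_zero_iff_of_nonneg hx).1 h.symm
    rw [Finset.sum_eq_zero fun i hi => by rw [this i hi, Real.negMulLog_zero]]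
    simp
  · set σ := ∑ i ∈ s, x i with hσ
    have hs : s.Nonempty := by
      by_contra hne
      rw [Finset.not_nonempty_iff_eq_empty] at hne
      simp [hσ, hne] at h
    have hc : (0 : ℝ) < s.card := by exact_mod_cast hs.card_pos
    calc ∑ i ∈ s, Real.negMulLog (x i)
        ≤ ∑ i ∈ s, (x i * -Real.log (σ / s.card) + (σ / s.card - x i)) :=
          Finset.sum_le_sum fun i hi => Real.negMulLog_le_tangent (hx i hi) (div_pos h hc)
      _ = σ * -Real.log (σ / s.card) := by
          rw [Finset.sum_add_distrib, ← Finset.sum_mul, Finset.sum_sub_distrib, ← hσ,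
            Finset.sum_const, nsmul_eq_mul]
          field_simp
          ring
      _ = _ := by
          rw [Real.log_div h.ne' hc.ne', Real.negMulLog]
          ring

theorem mul_binEntropy_le {r x : ℝ} (hr0 : 0 ≤ r) (hr1 : r ≤ 1) (hx0 : 0 ≤ x) (hx1 : x ≤ 1) :
    r * Real.binEntropy x ≤ Real.binEntropy (r * x) := by
  have h := Real.strictConcave_binEntropy.concaveOn.2 (x := x) (y := 0) ⟨hx0, hx1⟩ (by simp)
    hr0 (sub_nonneg.2 hr1) (by ring)
  simpa using h

theorem binEntropy_le_negMulLog_add {q : ℝ} (h1 : q ≤ 1) :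
    Real.binEntropy q ≤ Real.negMulLog q + q := by
  rw [Real.binEntropy_eq_negMulLog_add_negMulLog_one_sub]
  have := Real.negMulLog_le_tangent (x := 1 - q) (t := 1) (by linarith) one_pos
  simp at this
  linarith

theorem exp_neg_two_mul_le_one_sub {q : ℝ} (h0 : 0 ≤ q) (h1 : q ≤ 1 / 2) :
    Real.exp (-(2 * q)) ≤ 1 - q := by
  rw [Real.exp_neg, inv_le_comm₀ (Real.exp_pos _) (by linarith)]
  have h := Real.add_one_le_exp (2 * q)
  refine le_trans ?_ h
  rw [inv_le_iff_one_le_mul₀ (by linarith)]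
  nlinarith

/-- The binary entropy of a disjunction of independent events with small total probability, against
the sum of their binary entropies. -/
theorem sum_binEntropy_le_of_sum_le_one {m : ℕ} (q : Fin m → ℝ) (h0 : ∀ i, 0 ≤ q i)
    (h1 : ∀ i, q i ≤ 1 / 2) (hs : ∑ i, q i ≤ 1) :
    ∑ i, Real.binEntropy (q i) ≤
      8 * (1 + Real.log m) * Real.binEntropy (∏ i, (1 - q i)) := by
  set s := ∑ i, q i with hsdef
  set R := ∏ i, (1 - q i) with hR
  have hs0 : 0 ≤ s := Finset.sum_nonneg fun i _ => h0 i
  have hlow : Real.exp (-(2 * s)) ≤ R := by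
    rw [hsdef, Finset.mul_sum, ← Finset.sum_neg_distrib, Real.exp_sum]
    exact Finset.prod_le_prod (fun i _ => (Real.exp_pos _).le)
      fun i _ => exp_neg_two_mul_le_one_sub (h0 i) (h1 i)
  have hup : R ≤ Real.exp (-s) := by
    rw [hsdef, ← Finset.sum_neg_distrib, Real.exp_sum]
    refine Finset.prod_le_prod (fun i _ => by linarith [h1 i]) fun i _ => ?_
    have := Real.add_one_le_exp (-q i)
    linarith
  have hRpos : 0 < R := (Real.exp_pos _).trans_le hlow
  -- Since `s ≤ 1`, `R ≥ exp (-2)`, and `exp 2 ≤ 8`.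
  have hR8 : 1 / 8 ≤ R := by
    refine le_trans ?_ hlow
    have h2 : Real.exp (2 * s) ≤ 8 := by
      calc Real.exp (2 * s) ≤ Real.exp (1 + 1) := Real.exp_le_exp.2 (by linarith)
        _ = Real.exp 1 * Real.exp 1 := Real.exp_add _ _
        _ ≤ 8 := by nlinarith [Real.exp_one_lt_d9, Real.exp_pos 1]
    rw [Real.exp_neg, one_div]
    exact inv_anti₀ (Real.exp_pos _) h2
  have hRs : 1 - s ≤ R := one_sub_sum_le_prod_one_sub _ q (fun i _ => h0 i)
    fun i _ => by linarith [h1 i]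
  -- With `hRs`, this pins `1 - R` between `s / 2` and `s`, so its `negMulLog` is comparable to that
  -- of `s`.
  have hQ : s / 2 ≤ 1 - R := by
    have h3 : Real.exp (-s) ≤ 1 - s / 2 := by
      rw [Real.exp_neg, inv_le_comm₀ (Real.exp_pos _) (by linarith)]
      refine le_trans ?_ (Real.add_one_le_exp s)
      rw [inv_le_iff_one_le_mul₀ (by linarith)]
      nlinarith
    linarith
  have hfst : s / 8 ≤ Real.negMulLog R := by
    have hl : Real.log R ≤ -s := (Real.log_le_iff_le_exp hRpos).2 hup
    rw [Real.negMulLog]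
    nlinarith
  have hsnd : Real.negMulLog s / 2 ≤ Real.negMulLog (1 - R) := by
    rcases hs0.eq_or_lt with h | h
    · have : R = 1 := le_antisymm (by simpa [← h] using hup) (by linarith)
      simp [← h, this]
    · have hl : Real.log (1 - R) ≤ Real.log s := Real.log_le_log (by linarith) (by linarith)
      have hl0 : Real.log s ≤ 0 := Real.log_nonpos hs0 hs
      rw [Real.negMulLog, Real.negMulLog]
      nlinarith
  have hsum : ∑ i, Real.binEntropy (q i) ≤ s * Real.log m + Real.negMulLog s + s := by
    calc ∑ i, Real.binEntropy (q i) ≤ ∑ i, (Real.negMulLog (q i) + q i) :=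
          Finset.sum_le_sum fun i _ => binEntropy_le_negMulLog_add (by linarith [h1 i])
      _ ≤ _ := by
          rw [Finset.sum_add_distrib]
          have := sum_negMulLog_le Finset.univ q fun i _ => h0 i
          rw [Finset.card_univ, Fintype.card_fin] at this
          linarith
  have hm := Real.log_natCast_nonneg m
  have hns : 0 ≤ Real.negMulLog s := Real.negMulLog_nonneg hs0 hs
  have hb : s / 8 + Real.negMulLog s / 2 ≤ Real.binEntropy R := by
    rw [Real.binEntropy_eq_negMulLog_add_negMulLog_one_sub]
    linarith
  have := mul_le_mul_of_nonneg_left hb (a := 8 * (1 + Real.log m)) (by positivity)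
  nlinarith [mul_nonneg hm hns]

/-- The bare sum of entropies can far exceed the right side when the disjunction is almost certain.
The coefficient turns such terms negative, so no smallness of `q` is needed; it is averaged away
later using independence. -/
theorem sum_one_sub_mul_binEntropy_le {m : ℕ} (q : Fin m → ℝ) (h0 : ∀ i, 0 ≤ q i)
    (h1 : ∀ i, q i ≤ 1) :
    ∑ i, (1 - 2 * ∑ j ∈ Finset.univ.erase i, q j) * Real.binEntropy (q i) ≤
      8 * (1 + Real.log m) * Real.binEntropy (∏ i, (1 - q i)) := by
  have hm := Real.log_natCast_nonneg m
  have hR0 : 0 ≤ ∏ i, (1 - q i) := Finset.prod_nonneg fun i _ => by linarith [h1 i]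
  have hR1 : ∏ i, (1 - q i) ≤ 1 := Finset.prod_le_one (fun i _ => by linarith [h1 i])
    fun i _ => by linarith [h0 i]
  have hRb := Real.binEntropy_nonneg hR0 hR1
  have hb : ∀ i, 0 ≤ Real.binEntropy (q i) := fun i => Real.binEntropy_nonneg (h0 i) (h1 i)
  have herase : ∀ i, 0 ≤ ∑ j ∈ Finset.univ.erase i, q j :=
    fun i => Finset.sum_nonneg fun j _ => h0 j
  -- One large `q i` makes every other coefficient negative; the term `i` itself is handled by
  -- concavity of `Real.binEntropy`.
  by_cases hbig : ∃ i, 1 / 2 < q i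
  · obtain ⟨i, hi⟩ := hbig
    rw [← Finset.add_sum_erase _ _ (Finset.mem_univ i)]
    have hrest : ∑ k ∈ Finset.univ.erase i,
        (1 - 2 * ∑ j ∈ Finset.univ.erase k, q j) * Real.binEntropy (q k) ≤ 0 := by
      refine Finset.sum_nonpos fun k hk => mul_nonpos_of_nonpos_of_nonneg ?_ (hb k)
      have : q i ≤ ∑ j ∈ Finset.univ.erase k, q j :=
        Finset.single_le_sum (f := q) (fun j _ => h0 j)
          (Finset.mem_erase.2 ⟨(Finset.ne_of_mem_erase hk).symm, Finset.mem_univ i⟩)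
      linarith
    have hR := one_sub_sum_le_prod_one_sub (Finset.univ.erase i) q (fun j _ => h0 j)
      fun j _ => h1 j
    have hP0 : 0 ≤ ∏ j ∈ Finset.univ.erase i, (1 - q j) :=
      Finset.prod_nonneg fun i _ => by linarith [h1 i]
    have hP1 : ∏ j ∈ Finset.univ.erase i, (1 - q j) ≤ 1 :=
      Finset.prod_le_one (fun i _ => by linarith [h1 i]) fun i _ => by linarith [h0 i]
    have hmain := mul_binEntropy_le hP0 hP1 (x := 1 - q i) (by linarith [h1 i]) (by linarith [h0 i])
    rw [Finset.prod_erase_mul _ _ (Finset.mem_univ i), Real.binEntropy_one_sub] at hmain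
    have h2 : (1 - 2 * ∑ j ∈ Finset.univ.erase i, q j) * Real.binEntropy (q i) ≤
        (∏ j ∈ Finset.univ.erase i, (1 - q j)) * Real.binEntropy (q i) :=
      mul_le_mul_of_nonneg_right (by linarith [herase i]) (hb i)
    nlinarith [mul_nonneg hm hRb]
  · push Not at hbig
    by_cases hs : ∑ i, q i ≤ 1
    · refine le_trans (Finset.sum_le_sum fun i _ => ?_)
        (sum_binEntropy_le_of_sum_le_one q h0 hbig hs)
      have := herase i
      nlinarith [hb i]
    -- Total above `1` and each `q i ≤ 1/2`: the others sum to more than `1/2`, so every coefficient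
    -- is negative.
    · refine le_trans (Finset.sum_nonpos fun i _ => mul_nonpos_of_nonpos_of_nonneg ?_ (hb i))
        (by positivity)
      have := Finset.add_sum_erase Finset.univ q (Finset.mem_univ i)
      linarith [hbig i]

/-! ### Averaging over independent copies. -/

/-- The expectation of a product of independent factors. -/
theorem sum_prod_mul_prod {γ : Type*} [Fintype γ] {m : ℕ} (a : γ → ℝ) (F : Fin m → γ → ℝ) :
    ∑ c : Fin m → γ, (∏ k, a (c k)) * ∏ k, F k (c k) = ∏ k, ∑ c, a c * F k c := by
  classical
  rw [Finset.prod_univ_sum, Fintype.piFinset_univ]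
  simp_rw [Finset.prod_mul_distrib]

theorem sum_prod_mul_apply {γ : Type*} [Fintype γ] {m : ℕ} (a : γ → ℝ) (ha : ∑ c, a c = 1)
    (f : γ → ℝ) (i : Fin m) :
    ∑ c : Fin m → γ, (∏ k, a (c k)) * f (c i) = ∑ c, a c * f c := by
  have h := sum_prod_mul_prod a fun k c => if k = i then f c else 1
  simp only [mul_ite, mul_one] at h
  rw [Finset.prod_eq_single i (fun k _ hk => by simp [hk, ha]) (by simp)] at h
  simpa using h

theorem sum_prod_mul_apply_mul_apply {γ : Type*} [Fintype γ] {m : ℕ} (a : γ → ℝ)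
    (ha : ∑ c, a c = 1) (f g : γ → ℝ) {i j : Fin m} (hij : i ≠ j) :
    ∑ c : Fin m → γ, (∏ k, a (c k)) * (f (c i) * g (c j)) =
      (∑ c, a c * f c) * ∑ c, a c * g c := by
  have h := sum_prod_mul_prod a fun k c => (if k = i then f c else 1) * (if k = j then g c else 1)
  simp only [Finset.prod_mul_distrib, Finset.prod_ite_eq', Finset.mem_univ, if_true] at h
  rw [h, Fintype.prod_eq_mul i j hij fun k hk => by simp [hk.1, hk.2, ha]]
  simp [hij, hij.symm]

theorem sum_mul_binEntropy_le {γ : Type*} [Fintype γ] {m : ℕ} (a q : γ → ℝ)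
    (ha0 : ∀ c, 0 ≤ a c) (ha : ∑ c, a c = 1) (h0 : ∀ c, 0 ≤ q c) (h1 : ∀ c, q c ≤ 1)
    {p : ℝ} (hp : ∑ c, a c * q c ≤ p) (hm : (m - 1 : ℝ) * p ≤ 1 / 4) :
    m * ∑ c, a c * Real.binEntropy (q c) ≤ 16 * (1 + Real.log m) *
      ∑ c : Fin m → γ, (∏ k, a (c k)) * Real.binEntropy (∏ k, (1 - q (c k))) := by
  set E := ∑ c, a c * Real.binEntropy (q c) with hE
  have hE0 : 0 ≤ E := Finset.sum_nonneg fun c _ =>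
    mul_nonneg (ha0 c) (Real.binEntropy_nonneg (h0 c) (h1 c))
  -- By independence the coefficient averages separately from the entropy, to at least `1 - 2 (m -
  -- 1) p ≥ 1/2`. This doubles the constant `8` to `16`.
  have hterm : ∀ i : Fin m, E / 2 ≤ ∑ c : Fin m → γ, (∏ k, a (c k)) *
      ((1 - 2 * ∑ j ∈ Finset.univ.erase i, q (c j)) * Real.binEntropy (q (c i))) := by
    intro i
    have hpair : ∀ j ∈ Finset.univ.erase i, ∑ c : Fin m → γ, (∏ k, a (c k)) *
        (q (c j) * Real.binEntropy (q (c i))) = (∑ c, a c * q c) * E := fun j hj =>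
      sum_prod_mul_apply_mul_apply a ha q (fun c => Real.binEntropy (q c))
        (Finset.ne_of_mem_erase hj)
    have hcalc : ∑ c : Fin m → γ, (∏ k, a (c k)) *
        ((1 - 2 * ∑ j ∈ Finset.univ.erase i, q (c j)) * Real.binEntropy (q (c i))) =
        E - 2 * ((m - 1 : ℝ) * ((∑ c, a c * q c) * E)) := by
      have hcard : ((Finset.univ.erase i).card : ℝ) = m - 1 := by
        rw [Finset.card_erase_of_mem (Finset.mem_univ i), Finset.card_univ, Fintype.card_fin,
          Nat.cast_sub (by have := i.2; omega), Nat.cast_one]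
      rw [← hcard, ← nsmul_eq_mul, ← Finset.sum_const, ← Finset.sum_congr rfl hpair,
        Finset.sum_comm, Finset.mul_sum, hE,
        ← sum_prod_mul_apply a ha (fun c => Real.binEntropy (q c)) i, ← Finset.sum_sub_distrib]
      refine Finset.sum_congr rfl fun c _ => ?_
      rw [← Finset.mul_sum, ← Finset.sum_mul]
      ring
    rw [hcalc]
    have hm1 : (0 : ℝ) ≤ m - 1 := by
      have : (1 : ℝ) ≤ m := by exact_mod_cast (by have := i.2; omega : 1 ≤ m)
      linarith
    have : (m - 1 : ℝ) * (∑ c, a c * q c) ≤ 1 / 4 :=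
      (mul_le_mul_of_nonneg_left hp hm1).trans hm
    nlinarith [mul_le_mul_of_nonneg_right this hE0]
  have hsum := Finset.sum_le_sum fun (i : Fin m) (_ : i ∈ Finset.univ) => hterm i
  rw [Finset.sum_const, Finset.card_univ, Fintype.card_fin, nsmul_eq_mul, Finset.sum_comm] at hsum
  have hup : ∑ c : Fin m → γ, ∑ i, (∏ k, a (c k)) *
      ((1 - 2 * ∑ j ∈ Finset.univ.erase i, q (c j)) * Real.binEntropy (q (c i))) ≤
      8 * (1 + Real.log m) *
      ∑ c : Fin m → γ, (∏ k, a (c k)) * Real.binEntropy (∏ k, (1 - q (c k))) := by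
    rw [Finset.mul_sum]
    refine Finset.sum_le_sum fun c _ => ?_
    rw [← Finset.mul_sum]
    have := mul_le_mul_of_nonneg_left
      (sum_one_sub_mul_binEntropy_le (fun i => q (c i)) (fun i => h0 _) fun i => h1 _)
      (Finset.prod_nonneg fun k (_ : k ∈ Finset.univ) => ha0 (c k))
    refine this.trans (le_of_eq ?_)
    ring
  linarith

/-! ### Entropy and conditional entropy of finite-valued variables. -/

section Entropy

variable {Ω β γ : Type*} [Fintype Ω] [DecidableEq β] [DecidableEq γ]

/-- The mass that the weight `w` gives to the fiber of `f` over `b`. -/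
noncomputable def fiberMass (w : Ω → ℝ) (f : Ω → β) (b : β) : ℝ :=
  ∑ ω, if f ω = b then w ω else 0

/-- The Shannon entropy (in nats) of the random variable `f` under the weight `w`. -/
noncomputable def varEntropy [Fintype β] (w : Ω → ℝ) (f : Ω → β) : ℝ :=
  ∑ b, Real.negMulLog (fiberMass w f b)

/-- The entropy gained when a mass `x + y` is split into `x` and `y`. -/
noncomputable def splitEntropy (x y : ℝ) : ℝ :=
  Real.negMulLog x + Real.negMulLog y - Real.negMulLog (x + y)

theorem fiberMass_nonneg {w : Ω → ℝ} (hw : ∀ ω, 0 ≤ w ω) (f : Ω → β) (b : β) :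
    0 ≤ fiberMass w f b :=
  Finset.sum_nonneg fun ω _ => by split_ifs <;> simp [hw]

theorem sum_fiberMass [Fintype β] (w : Ω → ℝ) (f : Ω → β) : ∑ b, fiberMass w f b = ∑ ω, w ω := by
  unfold fiberMass
  rw [Finset.sum_comm]
  simp

theorem varEntropy_eq_sum [Fintype β] (w : Ω → ℝ) (f : Ω → β) :
    varEntropy w f = ∑ ω, w ω * -Real.log (fiberMass w f (f ω)) := by
  have h : ∀ b, Real.negMulLog (fiberMass w f b) =
      ∑ ω, if f ω = b then w ω * -Real.log (fiberMass w f b) else 0 := fun b => by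
    rw [Real.negMulLog, neg_mul, ← mul_neg]
    nth_rewrite 1 [fiberMass]
    rw [Finset.sum_mul]
    simp only [ite_mul, zero_mul]
  unfold varEntropy
  simp_rw [h]
  rw [Finset.sum_comm]
  simp

/-- The entropy of a random variable depends only on the partition it induces. -/
theorem varEntropy_congr [Fintype β] [Fintype γ] (w : Ω → ℝ) {f : Ω → β} {g : Ω → γ}
    (h : ∀ ω ω', f ω = f ω' ↔ g ω = g ω') : varEntropy w f = varEntropy w g := by
  rw [varEntropy_eq_sum, varEntropy_eq_sum]
  simp only [fiberMass, h]

theorem fiberMass_pair_add (w : Ω → ℝ) (f : Ω → β) (g : Ω → Bool) (b : β) :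
    fiberMass w (fun ω => (f ω, g ω)) (b, true) + fiberMass w (fun ω => (f ω, g ω)) (b, false) =
      fiberMass w f b := by
  unfold fiberMass
  rw [← Finset.sum_add_distrib]
  refine Finset.sum_congr rfl fun ω _ => ?_
  simp only [Prod.mk.injEq]
  cases g ω <;> simp

theorem varEntropy_pair [Fintype β] (w : Ω → ℝ) (f : Ω → β) (g : Ω → Bool) :
    varEntropy w (fun ω => (f ω, g ω)) = varEntropy w f +
      ∑ b, splitEntropy (fiberMass w (fun ω => (f ω, g ω)) (b, true))
        (fiberMass w (fun ω => (f ω, g ω)) (b, false)) := by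
  unfold varEntropy splitEntropy
  simp_rw [fiberMass_pair_add]
  rw [Fintype.sum_prod_type, Finset.sum_sub_distrib]
  simp

theorem splitEntropy_eq {x y : ℝ} (hx : 0 ≤ x) (hy : 0 ≤ y) :
    splitEntropy x y = (x + y) * Real.binEntropy (y / (x + y)) := by
  unfold splitEntropy
  rcases hx.eq_or_lt with rfl | hx
  · rcases hy.eq_or_lt with rfl | hy
    · simp
    · simp [hy.ne']
  · rcases hy.eq_or_lt with rfl | hy
    · simp
    · have h : 1 - y / (x + y) = x / (x + y) := by field_simp; ring
      rw [Real.binEntropy_eq_negMulLog_add_negMulLog_one_sub, h]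
      simp only [Real.negMulLog]
      rw [Real.log_div hx.ne' (by positivity), Real.log_div hy.ne' (by positivity)]
      field_simp
      ring

/-- Concavity of `Real.binEntropy` in homogeneous form, with the total masses as weights: merging
two fibers cannot lower the conditional entropy. -/
theorem splitEntropy_add_le {x y x' y' : ℝ} (hx : 0 ≤ x) (hy : 0 ≤ y) (hx' : 0 ≤ x')
    (hy' : 0 ≤ y') :
    splitEntropy x y + splitEntropy x' y' ≤ splitEntropy (x + x') (y + y') := by
  rcases (add_nonneg hx hy).eq_or_lt with h | h
  · have h1 : x = 0 := by linarith
    have h2 : y = 0 := by linarith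
    simp [h1, h2, splitEntropy]
  rcases (add_nonneg hx' hy').eq_or_lt with h' | h'
  · have h1 : x' = 0 := by linarith
    have h2 : y' = 0 := by linarith
    simp [h1, h2, splitEntropy]
  rw [splitEntropy_eq hx hy, splitEntropy_eq hx' hy',
    splitEntropy_eq (add_nonneg hx hx') (add_nonneg hy hy')]
  set u := x + y with hu
  set v := x' + y' with hv
  have hsum : x + x' + (y + y') = u + v := by rw [hu, hv]; ring
  rw [hsum]
  have hc := Real.strictConcave_binEntropy.concaveOn.2
    (show y / u ∈ Set.Icc (0 : ℝ) 1 from ⟨by positivity, (div_le_one h).2 (by linarith)⟩)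
    (show y' / v ∈ Set.Icc (0 : ℝ) 1 from ⟨by positivity, (div_le_one h').2 (by linarith)⟩)
    (show 0 ≤ u / (u + v) by positivity) (show 0 ≤ v / (u + v) by positivity) (by field_simp)
  have harg : (u / (u + v)) • (y / u) + (v / (u + v)) • (y' / v) = (y + y') / (u + v) := by
    simp only [smul_eq_mul]
    field_simp
  rw [harg] at hc
  have := mul_le_mul_of_nonneg_left hc (add_pos h h').le
  refine le_trans (le_of_eq ?_) this
  simp only [smul_eq_mul]
  field_simp

theorem sum_splitEntropy_le {ι : Type*} (s : Finset ι) (x y : ι → ℝ) (hx : ∀ i, 0 ≤ x i)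
    (hy : ∀ i, 0 ≤ y i) :
    ∑ i ∈ s, splitEntropy (x i) (y i) ≤ splitEntropy (∑ i ∈ s, x i) (∑ i ∈ s, y i) := by
  classical
  induction s using Finset.induction_on with
  | empty => simp [splitEntropy]
  | insert a s ha ih =>
    rw [Finset.sum_insert ha, Finset.sum_insert ha, Finset.sum_insert ha]
    have := splitEntropy_add_le (hx a) (hy a) (Finset.sum_nonneg fun i (_ : i ∈ s) => hx i)
      (Finset.sum_nonneg fun i (_ : i ∈ s) => hy i)
    linarith

/-- Conditioning on a finer random variable does not increase the conditional entropy. -/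
theorem varEntropy_add_le_varEntropy_pair [Fintype β] [Fintype γ] {w : Ω → ℝ}
    (hw : ∀ ω, 0 ≤ w ω) (f : Ω → β) (e : Ω → γ) (φ : γ → β) (hf : ∀ ω, f ω = φ (e ω)) (g : Ω → Bool) :
    varEntropy w f + ∑ c, splitEntropy (fiberMass w (fun ω => (e ω, g ω)) (c, true))
        (fiberMass w (fun ω => (e ω, g ω)) (c, false)) ≤
      varEntropy w (fun ω => (f ω, g ω)) := by
  have hfib : ∀ b t, fiberMass w (fun ω => (f ω, g ω)) (b, t) =
      ∑ c with φ c = b, fiberMass w (fun ω => (e ω, g ω)) (c, t) := by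
    intro b t
    unfold fiberMass
    rw [Finset.sum_comm]
    refine Finset.sum_congr rfl fun ω _ => ?_
    rw [Finset.sum_filter]
    rw [Finset.sum_eq_single (e ω)]
    · simp only [hf, Prod.mk.injEq]
      split_ifs <;> tauto
    · intro c _ hc
      simp [hc.symm]
    · simp
  rw [varEntropy_pair]
  simp_rw [hfib]
  gcongr
  rw [← Finset.sum_fiberwise Finset.univ φ]
  exact Finset.sum_le_sum fun b _ => sum_splitEntropy_le _ _ _
    (fun c => fiberMass_nonneg hw _ _) fun c => fiberMass_nonneg hw _ _

theorem fiberMass_pi {m : ℕ} (w : Ω → ℝ) (f : Ω → β) (c : Fin m → β) :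
    fiberMass (fun ω : Fin m → Ω => ∏ j, w (ω j)) (fun ω j => f (ω j)) c =
      ∏ j, fiberMass w f (c j) := by
  classical
  unfold fiberMass
  rw [Finset.prod_univ_sum, Fintype.piFinset_univ]
  refine Finset.sum_congr rfl fun ω _ => ?_
  rw [Finset.prod_ite_zero]
  simp [funext_iff]

theorem fiberMass_pi_exists_false {m : ℕ} (w : Ω → ℝ) (f : Ω → β) (g : Ω → Bool) (c : Fin m → β) :
    fiberMass (fun ω : Fin m → Ω => ∏ j, w (ω j))
      (fun ω => ((fun j => f (ω j)), decide (∃ j, g (ω j) = true))) (c, false) =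
      ∏ j, fiberMass w (fun ω => (f ω, g ω)) (c j, false) := by
  rw [← fiberMass_pi w (fun ω => (f ω, g ω)) fun j => (c j, false)]
  refine Finset.sum_congr rfl fun ω _ => ?_
  simp [funext_iff, forall_and]

/-- The conditional entropy of an event against that of a disjunction of `m` independent copies. -/
theorem mul_sum_splitEntropy_le [Fintype β] {m : ℕ} {w : Ω → ℝ} (hw : ∀ ω, 0 ≤ w ω)
    (hw1 : ∑ ω, w ω = 1) (f : Ω → β) (g : Ω → Bool) {p : ℝ} (hp : ∑ ω, (if g ω = true then w ω else 0) ≤ p)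
    (hm : (m - 1 : ℝ) * p ≤ 1 / 4) :
    m * ∑ b, splitEntropy (fiberMass w (fun ω => (f ω, g ω)) (b, true))
        (fiberMass w (fun ω => (f ω, g ω)) (b, false)) ≤
      16 * (1 + Real.log m) * ∑ c : Fin m → β,
        splitEntropy (fiberMass (fun ω : Fin m → Ω => ∏ j, w (ω j))
            (fun ω => ((fun j => f (ω j)), decide (∃ j, g (ω j) = true))) (c, true))
          (fiberMass (fun ω : Fin m → Ω => ∏ j, w (ω j))
            (fun ω => ((fun j => f (ω j)), decide (∃ j, g (ω j) = true))) (c, false)) := by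
  have hwm : ∀ ω : Fin m → Ω, 0 ≤ ∏ j, w (ω j) := fun ω => Finset.prod_nonneg fun j _ => hw _
  set x := fun b => fiberMass w (fun ω => (f ω, g ω)) (b, true) with hx
  set y := fun b => fiberMass w (fun ω => (f ω, g ω)) (b, false) with hy
  have hx0 : ∀ b, 0 ≤ x b := fun b => fiberMass_nonneg hw _ _
  have hy0 : ∀ b, 0 ≤ y b := fun b => fiberMass_nonneg hw _ _
  have hxy : ∀ b, x b + y b = fiberMass w f b := fiberMass_pair_add w f g
  -- The second function is the conditional probability of `g` given `f = b`. On a fiber of mass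
  -- zero it takes the value `1`, harmless because the weight there is `0`.
  have key := sum_mul_binEntropy_le (m := m) (fiberMass w f) (fun b => 1 - y b / fiberMass w f b)
    (fiberMass_nonneg hw f) ((sum_fiberMass w f).trans hw1)
    (fun b => sub_nonneg.2 (div_le_one_of_le₀ (by linarith [hxy b, hx0 b])
      (fiberMass_nonneg hw f b)))
    (fun b => sub_le_self _ (div_nonneg (hy0 b) (fiberMass_nonneg hw f b))) (p := p)
    (by
      refine le_trans (le_of_eq ?_) hp
      have h1 : ∀ b, fiberMass w f b * (1 - y b / fiberMass w f b) = x b := fun b => by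
        rcases (fiberMass_nonneg hw f b).eq_or_lt with h | h
        · rw [← h, zero_mul]
          linarith [hxy b, hx0 b, hy0 b]
        · rw [mul_sub, mul_div_cancel₀ _ h.ne', ← hxy]
          ring
      simp_rw [h1, hx, fiberMass]
      rw [Finset.sum_comm]
      refine Finset.sum_congr rfl fun ω _ => ?_
      by_cases hg : g ω = true <;> simp [hg])
    hm
  have hl : ∀ b, splitEntropy (x b) (y b) =
      fiberMass w f b * Real.binEntropy (1 - y b / fiberMass w f b) := fun b => by
    rw [splitEntropy_eq (hx0 b) (hy0 b), hxy, Real.binEntropy_one_sub]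
  have hr : ∀ c : Fin m → β, splitEntropy (fiberMass (fun ω : Fin m → Ω => ∏ j, w (ω j))
            (fun ω => ((fun j => f (ω j)), decide (∃ j, g (ω j) = true))) (c, true))
          (fiberMass (fun ω : Fin m → Ω => ∏ j, w (ω j))
            (fun ω => ((fun j => f (ω j)), decide (∃ j, g (ω j) = true))) (c, false)) =
      (∏ k, fiberMass w f (c k)) *
        Real.binEntropy (∏ k, (1 - (1 - y (c k) / fiberMass w f (c k)))) := fun c => by
    rw [splitEntropy_eq (fiberMass_nonneg hwm _ _) (fiberMass_nonneg hwm _ _),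
      fiberMass_pair_add _ (fun (ω : Fin m → Ω) j => f (ω j))
        (fun ω => decide (∃ j, g (ω j) = true)),
      fiberMass_pi, fiberMass_pi_exists_false]
    simp_rw [sub_sub_cancel]
    rw [Finset.prod_div_distrib]
  calc _ = _ := by rw [Finset.sum_congr rfl fun b _ => hl b]
    _ ≤ _ := key
    _ = _ := by rw [Finset.sum_congr rfl fun c _ => hr c]

theorem varEntropy_le_log_card [Fintype β] {w : Ω → ℝ} (hw : ∀ ω, 0 ≤ w ω)
    (hw1 : ∑ ω, w ω = 1) (f : Ω → β) (s : Finset β) (hs : ∀ ω, w ω ≠ 0 → f ω ∈ s) : varEntropy w f ≤ Real.log s.card := by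
  have h0 : ∀ b, b ∉ s → fiberMass w f b = 0 := fun b hb =>
    Finset.sum_eq_zero fun ω _ => by
      split_ifs with h
      · by_contra hne
        exact hb (h ▸ hs ω hne)
      · rfl
  have h1 : ∑ b ∈ s, fiberMass w f b = 1 := by
    rw [Finset.sum_subset (Finset.subset_univ s) fun b _ hb => h0 b hb, sum_fiberMass, hw1]
  have := sum_negMulLog_le s (fiberMass w f) fun b _ => fiberMass_nonneg hw f b
  rw [h1, Real.negMulLog_one] at this
  unfold varEntropy
  rw [← Finset.sum_subset (Finset.subset_univ s) fun b _ hb => by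
    rw [h0 b hb, Real.negMulLog_zero]]
  linarith

end Entropy

/-! ### The chain rule over coordinates. -/

/-- The part of `S` below the coordinate `i`. -/
def prefixTrace {n : ℕ} (i : ℕ) (S : Finset (Fin n)) : Finset (Fin n) := {j ∈ S | (j : ℕ) < i}

theorem prefixTrace_succ_eq_iff {n : ℕ} {i : ℕ} (hi : i < n) (S T : Finset (Fin n)) :
    prefixTrace (i + 1) S = prefixTrace (i + 1) T ↔
      (prefixTrace i S, decide ((⟨i, hi⟩ : Fin n) ∈ S)) =
        (prefixTrace i T, decide ((⟨i, hi⟩ : Fin n) ∈ T)) := by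
  simp only [prefixTrace, Prod.mk.injEq, Finset.ext_iff, Finset.mem_filter, decide_eq_decide]
  constructor
  · intro h
    refine ⟨fun j => ?_, ?_⟩
    · have := h j
      constructor
      · rintro ⟨h1, h2⟩
        exact ⟨(this.1 ⟨h1, by omega⟩).1, h2⟩
      · rintro ⟨h1, h2⟩
        exact ⟨(this.2 ⟨h1, by omega⟩).1, h2⟩
    · simpa using h ⟨i, hi⟩
  · rintro ⟨h1, h2⟩ j
    rcases lt_trichotomy (j : ℕ) i with h | h | h
    · have := h1 j
      simp only [h, and_true] at this
      rw [this]
    · obtain rfl : j = ⟨i, hi⟩ := Fin.ext h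
      rw [h2]
    · have : ¬ (j : ℕ) < i + 1 := by omega
      simp [this]

/-- The entropy of a random set all of whose coordinates are rare, against that of the union of
`m` independent copies. -/
theorem mul_varEntropy_le_varEntropy_biUnion {n m : ℕ} {w : Finset (Fin n) → ℝ}
    (hw : ∀ S, 0 ≤ w S) (hw1 : ∑ S, w S = 1) {p : ℝ}
    (hp : ∀ i : Fin n, ∑ S, (if i ∈ S then w S else 0) ≤ p) (hm : (m - 1 : ℝ) * p ≤ 1 / 4) :
    m * varEntropy w id ≤ 16 * (1 + Real.log m) *
      varEntropy (fun ω : Fin m → Finset (Fin n) => ∏ j, w (ω j))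
        (fun ω => Finset.univ.biUnion ω) := by
  have hwm : ∀ ω : Fin m → Finset (Fin n), 0 ≤ ∏ j, w (ω j) :=
    fun ω => Finset.prod_nonneg fun j _ => hw _
  have hwm1 : ∑ ω : Fin m → Finset (Fin n), ∏ j, w (ω j) = 1 := by
    have := sum_prod_mul_prod (m := m) w fun _ _ => 1
    simpa [hw1] using this
  have hlog := Real.log_natCast_nonneg m
  have main : ∀ i ≤ n, m * varEntropy w (prefixTrace i) ≤ 16 * (1 + Real.log m) *
      varEntropy (fun ω : Fin m → Finset (Fin n) => ∏ j, w (ω j))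
        (fun ω => prefixTrace i (Finset.univ.biUnion ω)) := by
    intro i
    induction i with
    | zero =>
      intro _
      rw [varEntropy_eq_sum, varEntropy_eq_sum]
      simp [prefixTrace, fiberMass, hw1, hwm1]
    | succ i ih =>
      intro hi
      rw [varEntropy_congr w (prefixTrace_succ_eq_iff hi), varEntropy_pair,
        varEntropy_congr _ fun ω ω' => prefixTrace_succ_eq_iff hi (Finset.univ.biUnion ω)
          (Finset.univ.biUnion ω')]
      -- Conditioning on the prefixes of all copies, which determine the prefix of the union, makes
      -- the bits of the copies independent.
      have hcond := varEntropy_add_le_varEntropy_pair hwm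
        (fun ω => prefixTrace i (Finset.univ.biUnion ω)) (fun ω j => prefixTrace i (ω j))
        (fun c => Finset.univ.biUnion c)
        (fun ω => by ext j; simp [prefixTrace])
        (fun ω => decide (∃ j, decide ((⟨i, hi⟩ : Fin n) ∈ ω j) = true))
      have hstep := mul_sum_splitEntropy_le hw hw1 (prefixTrace i)
        (fun S => decide ((⟨i, hi⟩ : Fin n) ∈ S)) (by simpa using hp ⟨i, hi⟩) hm
      have hmem : ∀ ω : Fin m → Finset (Fin n),
          decide ((⟨i, hi⟩ : Fin n) ∈ Finset.univ.biUnion ω) =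
            decide (∃ j, decide ((⟨i, hi⟩ : Fin n) ∈ ω j) = true) := fun ω => by simp
      simp_rw [hmem]
      have hcond' := mul_le_mul_of_nonneg_left hcond (a := 16 * (1 + Real.log m)) (by positivity)
      rw [mul_add] at hcond' ⊢
      linarith [ih (by omega)]
  have hid : ∀ S : Finset (Fin n), prefixTrace n S = S := fun S => by
    ext j
    simp [prefixTrace]
  have := main n le_rfl
  simp_rw [hid] at this
  rwa [show prefixTrace n = id from funext hid] at this

/-! ### Moonflower-freeness and VC dimension of unions. -/

/-- With `I` the complement of the private points, `S i \ I` is `{x i}`. -/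
theorem isMoonflower_of_private {n k : ℕ} {S : Fin k → Finset (Fin n)} (x : Fin k → Fin n)
    (hx : ∀ i j, x i ∈ S j ↔ i = j) : IsMoonflower S := by
  refine ⟨(Finset.univ.image x)ᶜ, fun i => ⟨x i, ?_⟩, fun i j hij => ?_⟩
  · simp [hx]
  · rw [Finset.disjoint_left]
    intro a ha hb
    simp only [Finset.mem_sdiff, Finset.mem_compl, Finset.mem_image, Finset.mem_univ, true_and,
      not_not] at ha hb
    obtain ⟨l, rfl⟩ := ha.2
    exact hij (((hx l i).1 ha.1).symm.trans ((hx l j).1 hb.1))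

/-- The unions of `m` members of `F`. -/
def unionFamily {n : ℕ} (m : ℕ) (F : Finset (Finset (Fin n))) : Finset (Finset (Fin n)) :=
  (Fintype.piFinset fun _ : Fin m => F).image fun ω => Finset.univ.biUnion ω

/-- If a union meets the `k`-set in one point only, the constituent containing that point meets it
there only. This works for every `m`. -/
theorem card_lt_of_shatters_unionFamily {n m k : ℕ} {F : Finset (Finset (Fin n))}
    (hF : MoonflowerFree k F) {X : Finset (Fin n)} (hX : (unionFamily m F).Shatters X) :
    X.card < k := by
  by_contra hk
  push Not at hk
  obtain ⟨Y, hYX, hY⟩ := Finset.exists_subset_card_eq hk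
  let x : Fin k → Fin n := fun i => (Y.equivFinOfCardEq hY).symm i
  have hxX : ∀ i, x i ∈ X := fun i => hYX ((Y.equivFinOfCardEq hY).symm i).2
  have hinj : Function.Injective x := fun i j h =>
    (Y.equivFinOfCardEq hY).symm.injective (Subtype.ext h)
  have hS : ∀ i, ∃ S ∈ F, ∀ j, x j ∈ S ↔ j = i := by
    intro i
    obtain ⟨U, hU, hUX⟩ := hX.exists_inter_eq_singleton (hxX i)
    have hmem : ∀ j, x j ∈ U ↔ j = i := fun j => by
      have := congrArg (x j ∈ ·) hUX
      simpa [hxX j, hinj.eq_iff] using this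
    obtain ⟨ω, hω, rfl⟩ := Finset.mem_image.1 hU
    obtain ⟨l, -, hl⟩ := Finset.mem_biUnion.1 ((hmem i).2 rfl)
    refine ⟨ω l, Fintype.mem_piFinset.1 hω l, fun j => ⟨fun hj => (hmem j).1 ?_, ?_⟩⟩
    · exact Finset.mem_biUnion.2 ⟨l, Finset.mem_univ l, hj⟩
    · rintro rfl
      exact hl
  choose S hSF hSx using hS
  exact hF ⟨S, hSF, isMoonflower_of_private x fun i j => hSx j i⟩

/-- Chernoff-type weighting: with `x = k / n ≤ 1`, multiplying by `x ^ k` is dominated by `(1 + x) ^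
n ≤ exp k`. -/
theorem sum_choose_le_pow {n k : ℕ} (hk : 0 < k) (hkn : k ≤ n) :
    ∑ j ∈ Finset.range (k + 1), (n.choose j : ℝ) ≤ (Real.exp 1 * n / k) ^ k := by
  have hk0 : (0 : ℝ) < k := by exact_mod_cast hk
  have hn0 : (0 : ℝ) < n := by exact_mod_cast hk.trans_le hkn
  set x : ℝ := k / n with hx
  have hx0 : 0 < x := div_pos hk0 hn0
  have hx1 : x ≤ 1 := (div_le_one hn0).2 (by exact_mod_cast hkn)
  have h1 : (∑ j ∈ Finset.range (k + 1), (n.choose j : ℝ)) * x ^ k ≤ Real.exp k := by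
    calc (∑ j ∈ Finset.range (k + 1), (n.choose j : ℝ)) * x ^ k
        ≤ ∑ j ∈ Finset.range (k + 1), x ^ j * (n.choose j : ℝ) := by
          rw [Finset.sum_mul]
          refine Finset.sum_le_sum fun j hj => ?_
          rw [mul_comm]
          exact mul_le_mul_of_nonneg_right (pow_le_pow_of_le_one hx0.le hx1
            (by simpa [Nat.lt_succ_iff] using hj)) (Nat.cast_nonneg _)
      _ ≤ ∑ j ∈ Finset.range (n + 1), x ^ j * (n.choose j : ℝ) :=
          Finset.sum_le_sum_of_subset_of_nonneg (Finset.range_mono (by omega))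
            fun _ _ _ => by positivity
      _ = (x + 1) ^ n := by simp [add_pow]
      _ ≤ Real.exp x ^ n := by gcongr; exact Real.add_one_le_exp x
      _ = Real.exp k := by
          rw [← Real.exp_nat_mul, hx]
          congr 1
          field_simp
  have h2 : (Real.exp 1 * n / k) ^ k = Real.exp k / x ^ k := by
    rw [mul_div_assoc, mul_pow, ← Real.exp_nat_mul, mul_one, hx, div_pow, div_pow]
    field_simp
  rw [h2, le_div_iff₀ (by positivity)]
  exact h1

theorem log_card_unionFamily_le {n m k : ℕ} {F : Finset (Finset (Fin n))}
    (hF : MoonflowerFree k F) (hk : 0 < k) (hkn : k ≤ n) (hne : (unionFamily m F).Nonempty) :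
    Real.log (unionFamily m F).card ≤ k * Real.log (Real.exp 1 * n / k) := by
  have hvc : (unionFamily m F).vcDim ≤ k :=
    Finset.sup_le fun X hX =>
      (card_lt_of_shatters_unionFamily hF (Finset.mem_shatterer.1 hX)).le
  have hcard : (unionFamily m F).card ≤ ∑ j ∈ Finset.range (k + 1), n.choose j := by
    refine (Finset.card_le_card_shatterer _).trans (Finset.card_shatterer_le_sum_vcDim.trans ?_)
    rw [Fintype.card_fin]
    refine Finset.sum_le_sum_of_subset fun j hj => ?_
    simp only [Finset.mem_Iic, Finset.mem_range] at hj ⊢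
    omega
  have hcard' : ((unionFamily m F).card : ℝ) ≤ (Real.exp 1 * n / k) ^ k := by
    refine le_trans ?_ (sum_choose_le_pow hk hkn)
    exact_mod_cast hcard
  rw [← Real.log_pow]
  exact Real.log_le_log (by exact_mod_cast hne.card_pos) hcard'

/-! ### Choice of the number of copies, and constants. -/

theorem shannonEntropy_mul_log_two {n : ℕ} (D : PMF (Finset (Fin n))) :
    shannonEntropy D * Real.log 2 = varEntropy (fun S => (D S).toReal) id := by
  unfold shannonEntropy varEntropy
  rw [Finset.sum_mul]
  refine Finset.sum_congr rfl fun S _ => ?_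
  have h2 : Real.log 2 ≠ 0 := (Real.log_pos one_lt_two).ne'
  have hS : fiberMass (fun S => (D S).toReal) id S = (D S).toReal := by simp [fiberMass]
  rw [hS, Real.negMulLog, Real.logb, one_div, Real.log_inv]
  field_simp

/-- Sampling about `1 / (4 p)` independent copies bounds the entropy of a `p`-smooth distribution
by the logarithm of the number of their possible unions. -/
theorem shannonEntropy_le_phi_mul_log {n k : ℕ} {F : Finset (Finset (Fin n))}
    (hF : MoonflowerFree k F) (hk : 0 < k) (hkn : k ≤ n) {p : ℝ} (hp0 : 0 < p) (hp : p ≤ 1 / 2)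
    {D : PMF (Finset (Fin n))} (hD : SupportedOn D F) (hs : IsSmooth p D) :
    shannonEntropy D ≤ 192 * (k * Real.log (Real.exp 1 * n / k)) * phi p := by
  set w : Finset (Fin n) → ℝ := fun S => (D S).toReal with hwdef
  have hw : ∀ S, 0 ≤ w S := fun S => ENNReal.toReal_nonneg
  have hw1 : ∑ S, w S = 1 := by
    rw [hwdef, ← ENNReal.toReal_sum fun S _ => D.apply_ne_top S, ← tsum_fintype (L := .unconditional _),
      D.tsum_coe, ENNReal.toReal_one]
  -- Rounding up past `1 / (4p)` gives `m ≥ 1 / (4p)`, while `m - 1 ≤ 1 / (4p)` is all the averaging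
  -- needs.
  set m : ℕ := ⌊1 / (4 * p)⌋₊ + 1 with hmdef
  have hmlow : 1 / (4 * p) ≤ m := by
    rw [hmdef]
    push_cast
    exact (Nat.lt_floor_add_one _).le
  have hmup : (m - 1 : ℝ) ≤ 1 / (4 * p) := by
    rw [hmdef]
    push_cast
    have := Nat.floor_le (show 0 ≤ 1 / (4 * p) by positivity)
    linarith
  have hmp : (m - 1 : ℝ) * p ≤ 1 / 4 := by
    have := mul_le_mul_of_nonneg_right hmup hp0.le
    refine this.trans (le_of_eq ?_)
    field_simp
  have hmain := mul_varEntropy_le_varEntropy_biUnion hw hw1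
    (fun i => by rw [← Finset.sum_filter]; exact hs i) hmp
  have hm0 : (0 : ℝ) < m := by rw [hmdef]; positivity
  have hsupp : ∀ ω : Fin m → Finset (Fin n), ∏ j, w (ω j) ≠ 0 →
      Finset.univ.biUnion ω ∈ unionFamily m F := fun ω hω => by
    refine Finset.mem_image_of_mem _ (Fintype.mem_piFinset.2 fun j => hD _ fun h0 => ?_)
    exact hω (Finset.prod_eq_zero (Finset.mem_univ j) (by simp [hwdef, h0]))
  have hwm1 : ∑ ω : Fin m → Finset (Fin n), ∏ j, w (ω j) = 1 := by
    have := sum_prod_mul_prod (m := m) w fun _ _ => 1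
    simpa [hw1] using this
  have hne : (unionFamily m F).Nonempty := by
    obtain ⟨ω, -, hω⟩ := Finset.exists_ne_zero_of_sum_ne_zero (hwm1.trans_ne one_ne_zero)
    exact ⟨_, hsupp ω hω⟩
  have hU := (varEntropy_le_log_card (fun ω => Finset.prod_nonneg fun j _ => hw _) hwm1
    (fun ω => Finset.univ.biUnion ω) (unionFamily m F) hsupp).trans
    (log_card_unionFamily_le hF hk hkn hne)
  set L := (k : ℝ) * Real.log (Real.exp 1 * n / k) with hL
  have hlog2 := Real.log_two_gt_d9
  set l := Real.log (1 / p) with hl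
  have hl2 : Real.log 2 ≤ l := Real.log_le_log two_pos (by rw [le_div_iff₀ hp0]; linarith)
  have hlm : Real.log m ≤ l := by
    refine Real.log_le_log hm0 ?_
    have h1 : (1 : ℝ) ≤ 3 / (4 * p) := by rw [le_div_iff₀ (by positivity)]; linarith
    have h2 : 1 / (4 * p) + 3 / (4 * p) = 1 / p := by field_simp; norm_num
    linarith
  have hL0 : 0 ≤ L :=
    (Real.log_natCast_nonneg _).trans (log_card_unionFamily_le (m := m) hF hk hkn hne)
  rw [← shannonEntropy_mul_log_two] at hmain
  have hH0 : 0 ≤ shannonEntropy D := Finset.sum_nonneg fun S _ => by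
    have hle : (D S).toReal ≤ 1 := ENNReal.toReal_le_of_le_ofReal zero_le_one (by
      simpa using D.coe_le_one S)
    rcases (hw S).eq_or_lt with h | h
    · rw [show (D S).toReal = 0 from h.symm, zero_mul]
    · exact mul_nonneg (hw S) (Real.logb_nonneg one_lt_two ((one_le_div h).2 hle))
  have hlog0 := Real.log_natCast_nonneg m
  -- As `l ≥ log 2 > 1/2`, `1 + log m ≤ 3 l`, whence `48 = 16 · 3`; dividing by `1 / (4p)` then
  -- gives `192`.
  have h1 : m * (shannonEntropy D * Real.log 2) ≤ 48 * l * L := by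
    calc m * (shannonEntropy D * Real.log 2) ≤ _ := hmain
      _ ≤ 16 * (1 + Real.log m) * L := mul_le_mul_of_nonneg_left hU (by positivity)
      _ ≤ 16 * (3 * l) * L := by gcongr; linarith
      _ = _ := by ring
  have h2 : 1 / (4 * p) * (shannonEntropy D * Real.log 2) ≤ 48 * l * L :=
    (mul_le_mul_of_nonneg_right hmlow (mul_nonneg hH0 (by linarith))).trans h1
  have h3 : shannonEntropy D * Real.log 2 ≤ 192 * L * (p * l) := by
    rw [div_mul_eq_mul_div, one_mul, div_le_iff₀ (by positivity)] at h2
    linarith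
  rw [phi, Real.logb, ← hl, ← mul_div_assoc, ← mul_div_assoc, le_div_iff₀ (by linarith)]
  exact h3

theorem theorem3p3 :
    ∃ B : ℝ, 1 ≤ B ∧
      ∀ (n k : ℕ) (F : Finset (Finset (Fin n))), MoonflowerFree k F →
        ∀ p : ℝ, 0 < p → p ≤ 1 / 2 →
          ∀ D : PMF (Finset (Fin n)), SupportedOn D F → IsSmooth p D →
            (2 * k ≤ n →
              shannonEntropy D ≤ B * (k * Real.logb 2 ((n : ℝ) / k)) * phi p) ∧
            (k ≤ n →
              shannonEntropy D ≤ B * (k * Real.logb 2 (Real.exp 1 * n / k)) * phi p) := by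
  -- `576 = 3 · 192`; the `3` absorbs the `e` in `log(en/k)` when `n ≥ 2k`.
  refine ⟨576, by norm_num, fun n k F hF p hp0 hp D hD hs => ?_⟩
  -- The empty tuple is vacuously a `0`-moonflower, so no family is `0`-moonflower-free.
  have hk : 0 < k := by
    rcases Nat.eq_zero_or_pos k with rfl | h
    · exact absurd ⟨fun i => i.elim0, fun i => i.elim0, ∅, fun i => i.elim0, fun i => i.elim0⟩ hF
    · exact h
  have hk0 : (0 : ℝ) < k := by exact_mod_cast hk
  have hphi : 0 ≤ phi p := mul_nonneg hp0.le
    (Real.logb_nonneg one_lt_two ((one_le_div hp0).2 (by linarith)))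
  have hlog2 := Real.log_two_gt_d9
  have hlog2' := Real.log_two_lt_d9
  have hlogb : ∀ x : ℝ, 1 ≤ x → Real.log x ≤ Real.logb 2 x := fun x hx => by
    rw [Real.logb, le_div_iff₀ (by linarith)]
    nlinarith [Real.log_nonneg hx]
  refine ⟨fun hn => ?_, fun hn => ?_⟩
  · refine (shannonEntropy_le_phi_mul_log hF hk (by omega) hp0 hp hD hs).trans
      (mul_le_mul_of_nonneg_right ?_ hphi)
    have hnk : (2 : ℝ) ≤ n / k := by
      rw [le_div_iff₀ hk0]
      exact_mod_cast hn
    have h1 := hlogb (n / k) (by linarith)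
    have h2 : Real.log 2 ≤ Real.log (n / k) := Real.log_le_log two_pos hnk
    rw [mul_div_assoc, Real.log_mul (Real.exp_pos 1).ne' (by linarith), Real.log_exp]
    have h3 : 1 + Real.log (n / k) ≤ 3 * Real.logb 2 (n / k) := by linarith
    have := mul_le_mul_of_nonneg_left h3 hk0.le
    linarith
  · refine (shannonEntropy_le_phi_mul_log hF hk hn hp0 hp hD hs).trans
      (mul_le_mul_of_nonneg_right ?_ hphi)
    have hnk : (1 : ℝ) ≤ n / k := by
      rw [le_div_iff₀ hk0]
      simpa using hn
    have he : (1 : ℝ) ≤ Real.exp 1 * n / k := by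
      rw [mul_div_assoc]
      nlinarith [Real.add_one_le_exp (1 : ℝ)]
    have h0 := Real.log_nonneg he
    have := mul_le_mul_of_nonneg_left (hlogb _ he) hk0.le
    nlinarith [mul_nonneg hk0.le h0]
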